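/- Let $n$ be a positive integer. Let $p(n)$ be the number of partitions of $n$, and let $p^{(2)}(n)$ be the number of partitions $\lambda_1\ge\lambda_2\ge\cdots\ge\lambda_k$ of $n$ with $\lambda_1\ge 2\lambda_2$, the one-part partition $[n]$ being included (set $\lambda_2=0$ if $k=1$). Consider the following algorithm with input $n$, which generates the ascending compositions of $n$. It uses integer variables $k,t,x,y$ and an integer array $a$ whose initial contents are arbitrary (the component $a_0$ may be read): $$\begin{array}{l} k\leftarrow 1\\ x\leftarrow 1\\ y\leftarrow n-1\\ \textbf{while } k>0 \textbf{ do}\\ \quad \textbf{while } 2x\le y \textbf{ do}\\ \quad\quad a_k\leftarrow x\\ \quad\quad y\leftarrow y-x\\ \quad\quad k\leftarrow k+1\\ \quad \textbf{end while}\\ \quad t\leftarrow k+1\\ \quad \textbf{while } x\le y \textbf{ do}\\ \quad\quad a_k\leftarrow x\\ \quad\quad a_t\leftarrow y\\ \quad\quad \textbf{visit } a_1,a_2,\ldots,a_t\\ \quad\quad x\leftarrow x+1\\ \quad\quad y\leftarrow y-1\\ \quad \textbf{end while}\\ \quad y\leftarrow x+y-1\\ \quad a_k\leftarrow y+1\\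 \quad \textbf{visit } a_1,a_2,\ldots,a_k\\ \quad k\leftarrow k-1\\ \quad x\leftarrow a_k+1\\ \textbf{end while} \end{array}$$ Every execution of a statement of the form "$\cdot\leftarrow\cdot$" counts as one assignment statement, and every evaluation of the condition of a while loop (including the last one, which ends the loop) counts as one evaluated boolean expression; the visit statements are not counted. Then the algorithm terminates, it executes exactly $4p(n)+4p^{(2)}(n)$ assignment statements, and it evaluates exactly $p(n)+3p^{(2)}(n)$ boolean expressions. -/

import Mathlib

/-! Integer partitions and the counting functions. -/

/-- The number `p(n)` of partitions of `n`. -/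
def numPartitions (n : ℕ) : ℕ := Fintype.card n.Partition

/-- The parts of a partition as a descending list `λ₁ ≥ λ₂ ≥ ⋯ ≥ λₖ`. -/
def descParts {n : ℕ} (μ : n.Partition) : List ℕ := μ.parts.sort (· ≥ ·)

/-- The number `p^{(t)}(n)` of partitions `λ` of `n` with `λ₁ ≥ t * λ₂`; a missing second part counts
as `0`, so that the one-part partition `[n]` is always included. -/
def numPartitionsRatio (t n : ℕ) : ℕ :=
  Fintype.card {μ : n.Partition //
    t * (descParts μ).getD 1 0 ≤ (descParts μ).getD 0 0}

/-! A small imperative language with integer variables, one integer array `a`, and a semantics that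
counts executed assignment statements and evaluated boolean expressions. -/

namespace Imp

/-- The scalar variables (`n` holds the input). -/
inductive Var
  | n | k | t | x | y
  deriving DecidableEq

/-- Integer expressions; `arr e` is the array component `a_e`. -/
inductive AExp
  | lit (z : ℤ)
  | var (v : Var)
  | arr (e : AExp)
  | add (e f : AExp)
  | sub (e f : AExp)
  | mul (e f : AExp)

/-- Boolean expressions: `e ≤ f` and `e > f`. -/
inductive BExp
  | le (e f : AExp)
  | gt (e f : AExp)

/-- Statements: `v ← e`, `a_i ← e`, `visit a_1, …, a_e`, sequencing and `while`. -/
inductive Com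
  | assign (v : Var) (e : AExp)
  | assignArr (i e : AExp)
  | visit (e : AExp)
  | seq (c d : Com)
  | while (b : BExp) (c : Com)

infixr:60 " ;; " => Com.seq

/-- A state: the values of the variables, the contents of the array, and the list of tuples visited
so far. -/
structure State where
  var : Var → ℤ
  arr : ℤ → ℤ
  out : List (List ℤ)

def AExp.eval (s : State) : AExp → ℤ
  | lit z => z
  | var v => s.var v
  | arr e => s.arr (e.eval s)
  | add e f => e.eval s + f.eval s
  | sub e f => e.eval s - f.eval s
  | mul e f => e.eval s * f.eval s

def BExp.Holds (s : State) : BExp → Prop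
  | le e f => e.eval s ≤ f.eval s
  | gt e f => e.eval s > f.eval s

def State.setVar (s : State) (v : Var) (z : ℤ) : State :=
  { s with var := Function.update s.var v z }

def State.setArr (s : State) (i z : ℤ) : State :=
  { s with arr := Function.update s.arr i z }

/-- Output the tuple `a_1, …, a_m`. -/
def State.emit (s : State) (m : ℤ) : State :=
  { s with out := s.out ++ [(List.range m.toNat).map fun i => s.arr ((i : ℤ) + 1)] }

/-- `Exec c s s' A B`: the program `c`, started in state `s`, terminates in state `s'`, having executed
exactly `A` assignment statements and evaluated exactly `B` boolean expressions. Each evaluation of the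
guard of a loop counts, including the one that ends the loop. -/
inductive Exec : Com → State → State → ℕ → ℕ → Prop
  | assign (v : Var) (e : AExp) (s : State) :
      Exec (.assign v e) s (s.setVar v (e.eval s)) 1 0
  | assignArr (i e : AExp) (s : State) :
      Exec (.assignArr i e) s (s.setArr (i.eval s) (e.eval s)) 1 0
  | visit (e : AExp) (s : State) :
      Exec (.visit e) s (s.emit (e.eval s)) 0 0
  | seq {c d : Com} {s s₁ s₂ : State} {A B A' B' : ℕ} :
      Exec c s s₁ A B → Exec d s₁ s₂ A' B' → Exec (c ;; d) s s₂ (A + A') (B + B')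
  | whileFalse {b : BExp} {c : Com} {s : State} :
      ¬ b.Holds s → Exec (.while b c) s s 0 1
  | whileTrue {b : BExp} {c : Com} {s s₁ s₂ : State} {A B A' B' : ℕ} :
      b.Holds s → Exec c s s₁ A B → Exec (.while b c) s₁ s₂ A' B' →
      Exec (.while b c) s s₂ (A + A') (1 + B + B')

/-- The algorithm generating the ascending compositions of the input `n`:
```
k ← 1;  x ← 1;  y ← n - 1
while k > 0
  while 2x ≤ y
    a_k ← x;  y ← y - x;  k ← k + 1
  t ← k + 1
  while x ≤ y
    a_k ← x;  a_t ← y;  visit a_1, …, a_t;  x ← x + 1;  y ← y - 1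
  y ← x + y - 1;  a_k ← y + 1;  visit a_1, …, a_k
  k ← k - 1;  x ← a_k + 1
``` -/
def genAscending : Com :=
  .assign .k (.lit 1) ;;
  .assign .x (.lit 1) ;;
  .assign .y (.sub (.var .n) (.lit 1)) ;;
  .while (.gt (.var .k) (.lit 0)) (
    .while (.le (.mul (.lit 2) (.var .x)) (.var .y)) (
      .assignArr (.var .k) (.var .x) ;;
      .assign .y (.sub (.var .y) (.var .x)) ;;
      .assign .k (.add (.var .k) (.lit 1))) ;;
    .assign .t (.add (.var .k) (.lit 1)) ;;
    .while (.le (.var .x) (.var .y)) (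
      .assignArr (.var .k) (.var .x) ;;
      .assignArr (.var .t) (.var .y) ;;
      .visit (.var .t) ;;
      .assign .x (.add (.var .x) (.lit 1)) ;;
      .assign .y (.sub (.var .y) (.lit 1))) ;;
    .assign .y (.sub (.add (.var .x) (.var .y)) (.lit 1)) ;;
    .assignArr (.var .k) (.add (.var .y) (.lit 1)) ;;
    .visit (.var .k) ;;
    .assign .k (.sub (.var .k) (.lit 1)) ;;
    .assign .x (.add (.arr (.var .k)) (.lit 1)))

end Imp

/-!
Write `m = x + y` at the head of the main loop. From there the algorithm handles the partitions of
`m` with all parts at least `x`, placing them in `a_k, a_{k+1}, …`, and then returns to the head of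
the loop with `k` decreased by one, without having touched the array below `k`
(`Imp.exists_exec_mainLoop`). If `3 * x ≤ m`, this work splits: the partitions with
smallest part `x` are handled by a push followed by the same task for `(x, m - x)`, the others by the
same task for `(x + 1, m)`. If `m < 3 * x`, a single round of the main loop visits the partitions
with at most two parts, which are all there are.

Hence the number of rounds of the main loop satisfies `v x m = v x (m - x) + v (x + 1) m` if
`3 * x ≤ m`, and `v x m = 1` otherwise. The number of partitions with `λ₁ ≥ 2 * λ₂` and parts at least
`x` satisfies the same recursion (`card_ratioPartitionsGE_step`, `card_ratioPartitionsGE_of_lt`):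
deleting the smallest part does not affect the two largest ones, except in `[m - x, x]`, where the
condition holds anyway. The total number of visits is the number of partitions, and since `k` goes
from `1` to `0`, the number of pushes is one less than the number of rounds. Adding up the costs of
pushes, pair visits and rounds gives the two formulas. As the semantics is deterministic
(`Imp.Exec.deterministic`), it suffices to exhibit one execution.
-/

/-! ### Partitions with parts bounded below -/

/-- The partitions of `m` with all parts at least `x` whose multiset of parts satisfies `Q`. -/
noncomputable def partitionsGE (Q : Multiset ℕ → Prop) (x m : ℕ) : Finset m.Partition :=
  open Classical in
  Finset.univ.filter fun μ => (∀ i ∈ μ.parts, x ≤ i) ∧ Q μ.parts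

theorem mem_partitionsGE {Q : Multiset ℕ → Prop} {x m : ℕ} {μ : m.Partition} :
    μ ∈ partitionsGE Q x m ↔ (∀ i ∈ μ.parts, x ≤ i) ∧ Q μ.parts := by
  simp [partitionsGE]

/-- The condition `λ₁ ≥ 2 * λ₂` on a multiset of parts, where missing parts count as `0`. -/
def IsRatioTwo (s : Multiset ℕ) : Prop :=
  2 * (s.sort (· ≥ ·)).getD 1 0 ≤ (s.sort (· ≥ ·)).getD 0 0

/-- Split according to whether `x` is a part; if so, delete one copy of it. -/
theorem card_partitionsGE_step {Q R : Multiset ℕ → Prop} {x m : ℕ} (hx : 0 < x) (hxm : x ≤ m)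
    (hQR : ∀ s : Multiset ℕ, s.sum = m - x → (∀ i ∈ s, x ≤ i) → (Q (x ::ₘ s) ↔ R s)) :
    (partitionsGE Q x m).card = (partitionsGE R x (m - x)).card + (partitionsGE Q (x + 1) m).card := by
  classical
  rw [← Finset.card_filter_add_card_filter_not (s := partitionsGE Q x m) (fun μ => x ∈ μ.parts)]
  congr 1
  · refine Finset.card_bij' (fun μ hμ => ⟨μ.parts.erase x, ?_, ?_⟩)
      (fun ν _ => ⟨x ::ₘ ν.parts, ?_, ?_⟩) ?_ ?_ ?_ ?_
    · intro i hi
      exact μ.parts_pos (Multiset.mem_of_mem_erase hi)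
    · have h := Multiset.sum_erase (Finset.mem_filter.1 hμ).2
      rw [μ.parts_sum] at h
      omega
    · intro i hi
      rcases Multiset.mem_cons.1 hi with rfl | hi
      · exact hx
      · exact ν.parts_pos hi
    · rw [Multiset.sum_cons, ν.parts_sum]
      omega
    · intro μ hμ
      obtain ⟨h₁, hmem⟩ := Finset.mem_filter.1 hμ
      obtain ⟨hge, hQ⟩ := mem_partitionsGE.1 h₁
      have hge' : ∀ i ∈ μ.parts.erase x, x ≤ i := fun i hi => hge i (Multiset.mem_of_mem_erase hi)
      have hsum := Multiset.sum_erase hmem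
      rw [μ.parts_sum] at hsum
      refine mem_partitionsGE.2 ⟨hge', (hQR _ (by omega) hge').1 ?_⟩
      rwa [Multiset.cons_erase hmem]
    · intro ν hν
      obtain ⟨hge, hR⟩ := mem_partitionsGE.1 hν
      refine Finset.mem_filter.2 ⟨mem_partitionsGE.2 ⟨?_, (hQR _ ν.parts_sum hge).2 hR⟩,
        Multiset.mem_cons_self x _⟩
      intro i hi
      rcases Multiset.mem_cons.1 hi with rfl | hi
      · exact le_rfl
      · exact hge i hi
    · intro μ hμ
      ext1
      exact Multiset.cons_erase (Finset.mem_filter.1 hμ).2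
    · intro ν _
      ext1
      exact Multiset.erase_cons_head _ _
  · congr 1
    ext μ
    simp only [Finset.mem_filter, mem_partitionsGE]
    constructor
    · rintro ⟨⟨hge, hQ⟩, hx⟩
      refine ⟨fun i hi => ?_, hQ⟩
      have := hge i hi
      have : i ≠ x := fun h => hx (h ▸ hi)
      omega
    · rintro ⟨hge, hQ⟩
      exact ⟨⟨fun i hi => (Nat.le_succ x).trans (hge i hi), hQ⟩,
        fun h => absurd (hge x h) (by omega)⟩

/-- If no other partition with parts at least `x` satisfies `Q`, only `[m]` remains. -/
theorem card_partitionsGE_eq_one {Q : Multiset ℕ → Prop} {x m : ℕ} (hxm : x ≤ m) (hm : 0 < m)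
    (hQ : Q {m})
    (h : ∀ s : Multiset ℕ, s.sum = m → (∀ i ∈ s, x ≤ i) → Q s → s = {m}) :
    (partitionsGE Q x m).card = 1 := by
  rw [Finset.card_eq_one]
  have hparts := Nat.Partition.indiscrete_parts hm.ne'
  refine ⟨Nat.Partition.indiscrete m, Finset.eq_singleton_iff_unique_mem.2 ⟨?_, ?_⟩⟩
  · rw [mem_partitionsGE, hparts]
    simpa using ⟨hxm, hQ⟩
  · intro μ hμ
    obtain ⟨hge, hQ⟩ := mem_partitionsGE.1 hμ
    ext1
    rw [hparts, h _ μ.parts_sum hge hQ]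

/-! ### The recursions for the two counts -/

theorem card_allPartitionsGE_step {x m : ℕ} (hx : 0 < x) (hxm : x ≤ m) :
    (partitionsGE (fun _ => True) x m).card =
      (partitionsGE (fun _ => True) x (m - x)).card +
        (partitionsGE (fun _ => True) (x + 1) m).card :=
  card_partitionsGE_step hx hxm fun _ _ _ => Iff.rfl

theorem card_allPartitionsGE_of_lt {x m : ℕ} (hxm : x ≤ m) (hm : m < 2 * x) :
    (partitionsGE (fun _ => True) x m).card = 1 := by
  refine card_partitionsGE_eq_one hxm (by omega) trivial fun s hs hge _ => ?_
  induction s using Multiset.induction with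
  | empty => simp at hs; omega
  | cons a s _ =>
    induction s using Multiset.induction with
    | empty => simpa using hs
    | cons b s _ =>
      have ha := hge a (by simp)
      have hb := hge b (by simp)
      simp only [Multiset.sum_cons] at hs
      omega

theorem card_allPartitionsGE_pos {x m : ℕ} (hxm : x ≤ m) (hm : 0 < m) :
    0 < (partitionsGE (fun _ => True) x m).card := by
  refine Finset.card_pos.2 ⟨Nat.Partition.indiscrete m, mem_partitionsGE.2 ⟨?_, trivial⟩⟩
  rw [Nat.Partition.indiscrete_parts hm.ne']
  simpa using hxm

theorem sort_cons_of_le {x : ℕ} {s : Multiset ℕ} (h : ∀ i ∈ s, x ≤ i) :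
    (x ::ₘ s).sort (· ≥ ·) = s.sort (· ≥ ·) ++ [x] := by
  refine List.Perm.eq_of_pairwise' (r := (· ≥ ·)) (Multiset.pairwise_sort _ _) ?_ ?_
  · rw [List.pairwise_append]
    refine ⟨Multiset.pairwise_sort _ _, List.pairwise_singleton _ _, ?_⟩
    intro a ha b hb
    rw [List.mem_singleton.1 hb]
    exact h a ((Multiset.mem_sort _).1 ha)
  · rw [← Multiset.coe_eq_coe, Multiset.sort_eq, ← Multiset.coe_add, Multiset.sort_eq, add_comm]
    rfl

/-- Adding a smallest part `x` keeps `λ₁ ≥ 2 * λ₂`; the case of a single other part, where `x` becomes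
`λ₂`, is covered by `2 * x ≤ s.sum`. -/
theorem isRatioTwo_cons {x : ℕ} {s : Multiset ℕ} (hx : 0 < x) (hs : 2 * x ≤ s.sum)
    (h : ∀ i ∈ s, x ≤ i) : IsRatioTwo (x ::ₘ s) ↔ IsRatioTwo s := by
  unfold IsRatioTwo
  rw [sort_cons_of_le h]
  rw [← Multiset.sort_eq s (· ≥ ·), Multiset.sum_coe] at hs
  match hl : s.sort (· ≥ ·) with
  | [] => simp [hl] at hs; omega
  | [a] => simpa [hl] using hs
  | a :: b :: l => simp

theorem card_ratioPartitionsGE_step {x m : ℕ} (hx : 0 < x) (hm : 3 * x ≤ m) :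
    (partitionsGE IsRatioTwo x m).card =
      (partitionsGE IsRatioTwo x (m - x)).card + (partitionsGE IsRatioTwo (x + 1) m).card :=
  card_partitionsGE_step hx (by omega) fun _ hs h => isRatioTwo_cons hx (by omega) h

/-- With two parts `λ₂ ≥ x` and `λ₁ ≥ 2 * λ₂`, the sum is at least `3 * x`. -/
theorem card_ratioPartitionsGE_of_lt {x m : ℕ} (hxm : x ≤ m) (hm : m < 3 * x) :
    (partitionsGE IsRatioTwo x m).card = 1 := by
  refine card_partitionsGE_eq_one hxm (by omega) (by simp [IsRatioTwo]) fun s hs hge hQ => ?_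
  unfold IsRatioTwo at hQ
  have hge' : ∀ i ∈ s.sort (· ≥ ·), x ≤ i := fun i hi => hge i ((Multiset.mem_sort _).1 hi)
  have heq := Multiset.sort_eq s (· ≥ ·)
  rw [← heq, Multiset.sum_coe] at hs
  match hl : s.sort (· ≥ ·) with
  | [] => simp [hl] at hs; omega
  | [a] =>
    rw [← heq, hl]
    simpa [hl] using hs
  | a :: b :: l =>
    rw [hl] at hs hQ hge'
    have hb := hge' b (by simp)
    simp at hs hQ
    omega

theorem card_allPartitionsGE_one (n : ℕ) :
    (partitionsGE (fun _ => True) 1 n).card = numPartitions n := by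
  rw [numPartitions, ← Finset.card_univ]
  congr 1
  ext μ
  simpa [mem_partitionsGE] using fun i hi => Nat.one_le_iff_ne_zero.2 (μ.parts_pos hi).ne'

theorem card_ratioPartitionsGE_one (n : ℕ) :
    (partitionsGE IsRatioTwo 1 n).card = numPartitionsRatio 2 n := by
  rw [numPartitionsRatio, Fintype.card_subtype]
  congr 1
  ext μ
  simp only [mem_partitionsGE, Finset.mem_filter, Finset.mem_univ, true_and]
  exact ⟨fun h => h.2, fun h => ⟨fun i hi => μ.parts_pos hi, h⟩⟩

namespace Imp

/-! ### Determinism of the semantics -/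

theorem Exec.deterministic {c : Com} {s s₁ s₂ : State} {A₁ B₁ A₂ B₂ : ℕ}
    (h₁ : Exec c s s₁ A₁ B₁) (h₂ : Exec c s s₂ A₂ B₂) : s₁ = s₂ ∧ A₁ = A₂ ∧ B₁ = B₂ := by
  induction h₁ generalizing s₂ A₂ B₂ with
  | assign | assignArr | visit => cases h₂; exact ⟨rfl, rfl, rfl⟩
  | seq _ _ ih ih' =>
    cases h₂ with
    | seq h h' =>
      obtain ⟨rfl, rfl, rfl⟩ := ih h
      obtain ⟨rfl, rfl, rfl⟩ := ih' h'
      exact ⟨rfl, rfl, rfl⟩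
  | whileFalse hb =>
    cases h₂ with
    | whileFalse => exact ⟨rfl, rfl, rfl⟩
    | whileTrue hb' => exact absurd hb' hb
  | whileTrue hb _ _ ih ih' =>
    cases h₂ with
    | whileFalse hb' => exact absurd hb hb'
    | whileTrue _ h h' =>
      obtain ⟨rfl, rfl, rfl⟩ := ih h
      obtain ⟨rfl, rfl, rfl⟩ := ih' h'
      exact ⟨rfl, rfl, rfl⟩

theorem Exec.congr_cost {c : Com} {s s' : State} {A B A' B' : ℕ} (h : Exec c s s' A B)
    (hA : A = A') (hB : B = B') : Exec c s s' A' B' :=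
  hA ▸ hB ▸ h

/-! ### The loops of the algorithm -/

/-- The body of the first inner loop: append `x` to the prefix. -/
def pushBody : Com :=
  .assignArr (.var .k) (.var .x) ;;
  .assign .y (.sub (.var .y) (.var .x)) ;;
  .assign .k (.add (.var .k) (.lit 1))

/-- The first inner loop. -/
def pushLoop : Com := .while (.le (.mul (.lit 2) (.var .x)) (.var .y)) pushBody

/-- The body of the second inner loop: visit the prefix followed by `x, y`. -/
def pairBody : Com :=
  .assignArr (.var .k) (.var .x) ;;
  .assignArr (.var .t) (.var .y) ;;
  .visit (.var .t) ;;
  .assign .x (.add (.var .x) (.lit 1)) ;;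
  .assign .y (.sub (.var .y) (.lit 1))

/-- The second inner loop. -/
def pairLoop : Com := .while (.le (.var .x) (.var .y)) pairBody

/-- The end of the main loop's body: visit the prefix followed by `x + y`, and shorten the prefix. -/
def popBody : Com :=
  .assign .y (.sub (.add (.var .x) (.var .y)) (.lit 1)) ;;
  .assignArr (.var .k) (.add (.var .y) (.lit 1)) ;;
  .visit (.var .k) ;;
  .assign .k (.sub (.var .k) (.lit 1)) ;;
  .assign .x (.add (.arr (.var .k)) (.lit 1))

/-- The main loop. -/
def mainLoop : Com :=
  .while (.gt (.var .k) (.lit 0))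
    (pushLoop ;; .assign .t (.add (.var .k) (.lit 1)) ;; pairLoop ;; popBody)

theorem exists_exec_pushBody (s : State) :
    ∃ s', Exec pushBody s s' 3 0 ∧ s'.var .k = s.var .k + 1 ∧ s'.var .x = s.var .x ∧
      s'.var .y = s.var .y - s.var .x ∧ s'.arr = Function.update s.arr (s.var .k) (s.var .x) := by
  refine ⟨_, .seq (.assignArr _ _ _) (.seq (.assign _ _ _) (.assign _ _ _)), ?_⟩
  simp [State.setVar, State.setArr, AExp.eval]

theorem exists_exec_pairBody (s : State) :
    ∃ s', Exec pairBody s s' 4 0 ∧ s'.var .k = s.var .k ∧ s'.var .t = s.var .t ∧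
      s'.var .x = s.var .x + 1 ∧ s'.var .y = s.var .y - 1 ∧
      s'.arr = Function.update (Function.update s.arr (s.var .k) (s.var .x))
        (s.var .t) (s.var .y) := by
  refine ⟨_, .seq (.assignArr _ _ _) (.seq (.assignArr _ _ _) (.seq (.visit _ _)
    (.seq (.assign _ _ _) (.assign _ _ _)))), ?_⟩
  simp [State.setVar, State.setArr, State.emit, AExp.eval]

theorem exists_exec_popBody (s : State) :
    ∃ s', Exec popBody s s' 4 0 ∧ s'.var .k = s.var .k - 1 ∧
      s'.var .x = s'.arr (s.var .k - 1) + 1 ∧ s'.var .y = s.var .x + s.var .y - 1 ∧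
      s'.arr = Function.update s.arr (s.var .k) (s.var .x + s.var .y) := by
  refine ⟨_, .seq (.assign _ _ _) (.seq (.assignArr _ _ _) (.seq (.visit _ _)
    (.seq (.assign _ _ _) (.assign _ _ _)))), ?_⟩
  simp [State.setVar, State.setArr, State.emit, AExp.eval]

/-- If `x + y < 3 * x`, the second inner loop visits all partitions of `x + y` with parts at least `x`,
except for the one-part partition. -/
theorem exists_exec_pairLoop (s : State) (x y : ℕ) (hx : 0 < x) (hy : y < 2 * x)
    (hsx : s.var .x = x) (hsy : s.var .y = y) (hst : s.var .t = s.var .k + 1) :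
    ∃ s' v, Exec pairLoop s s' (4 * v) (v + 1) ∧
      v + 1 = (partitionsGE (fun _ => True) x (x + y)).card ∧
      s'.var .k = s.var .k ∧ s'.var .x + s'.var .y = x + y ∧
      ∀ i < s.var .k, s'.arr i = s.arr i := by
  induction y using Nat.strong_induction_on generalizing s x with
  | _ y ih =>
    by_cases hxy : x ≤ y
    · obtain ⟨s₁, h₁, hk, ht, hx₁, hy₁, ha⟩ := exists_exec_pairBody s
      obtain ⟨s', v, h', hv, hk', hxy', ha'⟩ := ih (y - 1) (by omega) s₁ (x + 1) (by omega)
        (by omega) (by rw [hx₁, hsx]; push_cast; rfl) (by omega) (by omega)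
      refine ⟨s', v + 1, ?_, ?_, by omega, by omega, ?_⟩
      · refine (Exec.whileTrue ?_ h₁ h').congr_cost (by ring) (by ring)
        simp only [BExp.Holds, AExp.eval]
        omega
      · rw [card_allPartitionsGE_step hx (by omega), Nat.add_sub_cancel_left,
          card_allPartitionsGE_of_lt hxy hy, hv, show x + 1 + (y - 1) = x + y by omega, add_comm]
      · intro i hi
        rw [ha' i (by omega), ha, Function.update_of_ne (by omega), Function.update_of_ne (by omega)]
    · refine ⟨s, 0, Exec.whileFalse ?_, ?_, rfl, by omega, fun _ _ => rfl⟩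
      · simp only [BExp.Holds, AExp.eval]; omega
      · rw [card_allPartitionsGE_of_lt (by omega) (by omega)]

/-- A push can be moved in front of the main loop: if `2 * x ≤ y`, executing the main loop amounts to
one round of the first inner loop followed by the main loop. -/
theorem exec_mainLoop_of_push {s s₁ s' : State} {A B : ℕ} (hk : 0 < s.var .k)
    (hk₁ : 0 < s₁.var .k) (hxy : 2 * s.var .x ≤ s.var .y) (hpush : Exec pushBody s s₁ 3 0)
    (h : Exec mainLoop s₁ s' A B) : Exec mainLoop s s' (A + 3) (B + 1) := by
  cases h with
  | whileFalse hb => exact absurd hk₁ hb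
  | whileTrue _ hbody hrest =>
    cases hbody with
    | seq hp hq =>
      exact (Exec.whileTrue (b := .gt (.var .k) (.lit 0)) hk
        (Exec.seq (Exec.whileTrue (b := .le (.mul (.lit 2) (.var .x)) (.var .y)) hxy hpush hp) hq)
        hrest).congr_cost (by ring) (by ring)

/-- The state `s₁` is one in which the main loop, entered in state `s` at position `k` with remaining
sum `m`, returns to its head with position `k - 1`: the array below `k` is that of `s`, and `x` and `y`
are set to continue after the entry `a_{k-1}`. For `k = 1` the value of `x` comes from the arbitrary
`a_0`; it is never used, as the loop then ends. -/
structure IsReturn (s s₁ : State) (k m : ℤ) : Prop where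
  k_eq : s₁.var .k = k - 1
  x_eq : s₁.var .x = s₁.arr (k - 1) + 1
  y_eq : s₁.var .y = m - 1
  arr_eq : ∀ i < k, s₁.arr i = s.arr i

/-- One round of the main loop without pushes. -/
theorem exists_exec_round (s : State) (x y : ℕ) (hx : 0 < x) (hy : y < 2 * x)
    (hsk : 0 < s.var .k) (hsx : s.var .x = x) (hsy : s.var .y = y) :
    ∃ s₁ v, IsReturn s s₁ (s.var .k) (x + y) ∧
      v + 1 = (partitionsGE (fun _ => True) x (x + y)).card ∧
      ∀ s' A B, Exec mainLoop s₁ s' A B →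
        Exec mainLoop s s' (A + (4 * v + 5)) (B + (v + 3)) := by
  obtain ⟨s₂, v, h₂, hv, hk₂, hxy₂, ha₂⟩ := exists_exec_pairLoop
    (s.setVar .t (s.var .k + 1)) x y hx hy (by simpa [State.setVar] using hsx)
    (by simpa [State.setVar] using hsy) (by simp [State.setVar])
  obtain ⟨s₃, h₃, hk₃, hx₃, hy₃, ha₃⟩ := exists_exec_popBody s₂
  simp only [State.setVar, Function.update_of_ne (show Var.k ≠ Var.t by decide)] at hk₂ ha₂
  refine ⟨s₃, v, ⟨by omega, by rw [hx₃, hk₂], by omega, ?_⟩, hv, ?_⟩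
  · intro i hi
    rw [ha₃, Function.update_of_ne (by omega), ha₂ i hi]
  · intro s' A B h
    refine (Exec.whileTrue (b := .gt (.var .k) (.lit 0)) hsk
      (Exec.seq (Exec.whileFalse ?_) (Exec.seq (Exec.assign _ _ _) (Exec.seq h₂ h₃)))
      h).congr_cost (by ring) (by ring)
    simp only [BExp.Holds, AExp.eval]
    omega

/-- The cost `(A', B')` of the task for `(x, m)` together with what follows it, where the latter costs
`(A, B)`. The constants `3` and `1` account for the number of pushes being one less than the number of
rounds. -/
theorem exists_exec_mainLoop (s : State) (x m : ℕ) (hx : 0 < x) (hxm : x ≤ m)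
    (hsk : 0 < s.var .k) (hsx : s.var .x = x) (hsy : s.var .y = m - x) {A B A' B' : ℕ}
    (hA : A' + 3 = A + 4 * (partitionsGE (fun _ => True) x m).card
      + 4 * (partitionsGE IsRatioTwo x m).card)
    (hB : B' + 1 = B + (partitionsGE (fun _ => True) x m).card
      + 3 * (partitionsGE IsRatioTwo x m).card)
    (hret : ∀ s₁, IsReturn s s₁ (s.var .k) m → ∃ s', Exec mainLoop s₁ s' A B) :
    ∃ s', Exec mainLoop s s' A' B' := by
  induction hd : m - x using Nat.strong_induction_on generalizing s x m A B A' B' with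
  | _ d ih =>
    by_cases h3 : 3 * x ≤ m
    · rw [card_allPartitionsGE_step hx hxm, card_ratioPartitionsGE_step hx h3] at hA hB
      have hpos := card_allPartitionsGE_pos (x := x + 1) (m := m) (by omega) (by omega)
      have hpos' := card_allPartitionsGE_pos (x := x) (m := m - x) (by omega) (by omega)
      -- The cost of the task for `(x + 1, m)` and what follows it.
      obtain ⟨A₁, hA₁⟩ : ∃ A₁, A₁ + 3 = A + 4 * (partitionsGE (fun _ => True) (x + 1) m).card
        + 4 * (partitionsGE IsRatioTwo (x + 1) m).card := ⟨_ - _, Nat.sub_add_cancel (by omega)⟩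
      obtain ⟨B₁, hB₁⟩ : ∃ B₁, B₁ + 1 = B + (partitionsGE (fun _ => True) (x + 1) m).card
        + 3 * (partitionsGE IsRatioTwo (x + 1) m).card := ⟨_ - _, Nat.sub_add_cancel (by omega)⟩
      obtain ⟨s₁, h₁, hk₁, hx₁, hy₁, ha₁⟩ := exists_exec_pushBody s
      -- The task for `(x, m - x)`, one position further to the right, starts after the push.
      obtain ⟨s', h'⟩ : ∃ s', Exec mainLoop s₁ s' (A' - 3) (B' - 1) := by
        refine ih (m - x - x) (by omega) s₁ x (m - x) hx (by omega) (by omega) (by omega) (by omega)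
          (A := A₁) (B := B₁) (by omega) (by omega) (fun s₂ hs₂ => ?_) rfl
        -- Upon its return, `a_k = x` turns `(x, m - x)` into `(x + 1, m)`.
        obtain ⟨hk₂, hx₂, hy₂, ha₂⟩ := hs₂
        have hak : s₂.arr (s.var .k) = x := by
          rw [ha₂ _ (by omega), ha₁, Function.update_self, hsx]
        rw [hk₁] at hk₂ hx₂ ha₂
        rw [add_sub_cancel_right] at hk₂ hx₂
        refine ih (m - (x + 1)) (by omega) s₂ (x + 1) m (by omega) (by omega) (by omega)
          (by rw [hx₂, hak]; push_cast; rfl) (by omega) hA₁ hB₁ (fun s₃ hs₃ => hret s₃ ?_) rfl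
        obtain ⟨hk₃, hx₃, hy₃, ha₃⟩ := hs₃
        rw [hk₂] at hk₃ hx₃ ha₃
        refine ⟨hk₃, hx₃, hy₃, fun i hi => ?_⟩
        rw [ha₃ i hi, ha₂ i (by omega), ha₁, Function.update_of_ne (by omega)]
      exact ⟨s', (exec_mainLoop_of_push hsk (by omega) (by omega) h₁ h').congr_cost
        (by omega) (by omega)⟩
    · obtain ⟨y, rfl⟩ := Nat.exists_eq_add_of_le hxm
      obtain ⟨s₁, v, hs₁, hv, h⟩ := exists_exec_round s x y hx (by omega) hsk hsx (by omega)
      obtain ⟨s', h'⟩ := hret s₁ (by push_cast; exact hs₁)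
      rw [card_ratioPartitionsGE_of_lt hxm (by omega), ← hv] at hA hB
      exact ⟨s', (h s' A B h').congr_cost (by omega) (by omega)⟩

theorem exists_exec_genAscending (n : ℕ) (hn : 0 < n) (s : State) (hs : s.var .n = n) :
    ∃ s', Exec genAscending s s' (4 * numPartitions n + 4 * numPartitionsRatio 2 n)
      (numPartitions n + 3 * numPartitionsRatio 2 n) := by
  have hpos := card_allPartitionsGE_pos (x := 1) (m := n) hn hn
  rw [card_allPartitionsGE_one] at hpos
  obtain ⟨s', h⟩ := exists_exec_mainLoop (((s.setVar .k 1).setVar .x 1).setVar .y (n - 1)) 1 n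
    Nat.one_pos hn (by simp [State.setVar]) (by simp [State.setVar]) (by simp [State.setVar])
    (A := 0) (B := 1) (A' := 4 * numPartitions n + 4 * numPartitionsRatio 2 n - 3)
    (B' := numPartitions n + 3 * numPartitionsRatio 2 n)
    (by rw [card_allPartitionsGE_one, card_ratioPartitionsGE_one]; omega)
    (by rw [card_allPartitionsGE_one, card_ratioPartitionsGE_one]; omega)
    (fun s₁ hs₁ => ⟨s₁, Exec.whileFalse (by
      have := hs₁.k_eq
      simp [State.setVar] at this
      simp [BExp.Holds, AExp.eval, this])⟩)
  have hy : AExp.eval ((s.setVar .k 1).setVar .x 1) (.sub (.var .n) (.lit 1)) = n - 1 := by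
    simp [State.setVar, AExp.eval, hs]
  rw [← hy] at h
  exact ⟨s', (Exec.seq (Exec.assign .k (.lit 1) s) (Exec.seq (Exec.assign .x (.lit 1) _)
    (Exec.seq (Exec.assign .y (.sub (.var .n) (.lit 1)) _) h))).congr_cost (by omega) (by omega)⟩

end Imp

theorem theorem5 (n : ℕ) (hn : 0 < n) (s : Imp.State) (hs : s.var Imp.Var.n = (n : ℤ)) :
    (∃ s' A B, Imp.Exec Imp.genAscending s s' A B) ∧
    ∀ (s' : Imp.State) (A B : ℕ), Imp.Exec Imp.genAscending s s' A B →
      A = 4 * numPartitions n + 4 * numPartitionsRatio 2 n ∧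
      B = numPartitions n + 3 * numPartitionsRatio 2 n := by
  obtain ⟨s₁, h₁⟩ := Imp.exists_exec_genAscending n hn s hs
  exact ⟨⟨s₁, _, _, h₁⟩, fun _ _ _ h => (h.deterministic h₁).2⟩
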